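/- For $\operatorname{Re} u<1$ and $-1<x<1$ let $$P_v^u(x)=\frac{1}{\Gamma(1-u)}\left(\frac{1+x}{1-x}\right)^{u/2}{}_2F_1\!\left(-v,v+1;1-u;\tfrac{1-x}{2}\right)$$ be the associated Legendre function of the first kind on the cut, with complex degree $v$ and complex order $u$. Let $m,u,v,\mu,\nu\in\mathbb{C}$ satisfy $0<\operatorname{Re}(m)<1$, $\operatorname{Re}(u)<1$, $\operatorname{Re}(v)>0$, $\operatorname{Re}(m)<|\operatorname{Re}(v)|$, $\operatorname{Re}(\mu)<1$, $\operatorname{Re}(\nu)>0$, $\operatorname{Re}(m)<|\operatorname{Re}(\nu)|$, and suppose that the exponents of $\log(1/z)$ and $\log(1/p)$ below satisfy the convergence conditions $$\operatorname{Re}\,\tfrac12(m-u-v-1)>-1,\qquad \operatorname{Re}\,\tfrac12(-\mu-m-\nu)>-1 .$$ Then the following integral converges absolutely (the integrand is integrable on $(0,1)^6$) and $$\int_{0}^{1}\!\int_{0}^{1}\!\int_{0}^{1}\!\int_{0}^{1}\!\int_{0}^{1}\!\int_{0}^{1}x^{m-1} y^{-m} (1-x^2)^{-u/2} (1-y^2)^{-\mu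 /2}\, P_v^u(x)\, P_{\nu }^{\mu }(y)\, \log ^{\frac{1}{2} (-\mu -m-\nu)}\!\left(\tfrac{1}{p}\right) \log ^{\frac{1}{2} (-\mu -m+\nu+1)}\!\left(\tfrac{1}{q}\right) \log ^{\frac{1}{2}(m-u+v)}\!\left(\tfrac{1}{t}\right) \log ^{\frac{1}{2}(m-u-v-1)}\!\left(\tfrac{1}{z}\right)dx\,dy\,dz\,dt\,dp\,dq=\pi ^2 \csc (\pi m)\, 2^{\mu +u-1}.$$ -/

import Mathlib

open MeasureTheory

noncomputable section

/-- The associated Legendre function of the first kind `P_v^u(x)` on the cut `-1 < x < 1`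
(the Ferrers function), of degree `v` and order `u`:
`((1 + x) / (1 - x)) ^ (u / 2) / Γ(1 - u) * ₂F₁(-v, v + 1; 1 - u; (1 - x) / 2)`.
It is used only for `Re u < 1`, where `1 - u` is not a pole of `Γ`. -/
def legendreP (v u : ℂ) (x : ℝ) : ℂ :=
  (((1 + x) / (1 - x) : ℝ) : ℂ) ^ (u / 2) / Complex.Gamma (1 - u) *
    ordinaryHypergeometric (-v) (v + 1) (1 - u) (((1 - x) / 2 : ℝ) : ℂ)

/-- The integrand of the sextuple integral. All bases of the complex powers are positive reals
when the six variables lie in `(0, 1)`. -/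
def sextupleKernel (m u v μ ν : ℂ) (x y z t p q : ℝ) : ℂ :=
  (x : ℂ) ^ (m - 1) * (y : ℂ) ^ (-m) *
    ((1 - x ^ 2 : ℝ) : ℂ) ^ (-u / 2) * ((1 - y ^ 2 : ℝ) : ℂ) ^ (-μ / 2) *
    legendreP v u x * legendreP ν μ y *
    (Real.log (1 / p) : ℂ) ^ ((-μ - m - ν) / 2) *
    (Real.log (1 / q) : ℂ) ^ ((-μ - m + ν + 1) / 2) *
    (Real.log (1 / t) : ℂ) ^ ((m - u + v) / 2) *
    (Real.log (1 / z) : ℂ) ^ ((m - u - v - 1) / 2)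

end

/-! The kernel is a product of six functions of one variable. The substitution `x = exp (-s)` makes
each logarithmic integral a Gamma value. In the Mellin transform of `(1 - x²) ^ (-u / 2) * P_v^u`,
the powers of `1 + x` cancel, and termwise Beta integration leaves `₂F₁(-v, v + 1; σ + 1 - u; 1/2)`,
which Bailey's theorem evaluates. At `σ = m` and `σ = 1 - m` its Gamma denominators are exactly the
four logarithmic integrals, so only powers of 2, `π` and `Γ(m) Γ(1 - m) = π / sin (π m)` survive.
Bailey's theorem comes from a contiguous relation `c ↦ c + 2`: iterated, it gives a finite product
times a series tending to 1, and Euler's limit for `Γ` identifies the product. -/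

/-! ### Bailey's summation theorem. -/

/-- The `n`-th term of the series `₂F₁(a, 1 - a; c; 1/2)`. -/
noncomputable def baileyTerm (a c : ℂ) (n : ℕ) : ℂ :=
  ((n.factorial : ℂ)⁻¹ * (ascPochhammer ℂ n).eval a * (ascPochhammer ℂ n).eval (1 - a) *
    ((ascPochhammer ℂ n).eval c)⁻¹) * (1 / 2) ^ n

theorem add_natCast_ne_zero_of_re_pos {c : ℂ} (hc : 0 < c.re) (n : ℕ) : c + n ≠ 0 := by
  intro h
  have := congrArg Complex.re h
  simp at this
  have : (0 : ℝ) ≤ n := n.cast_nonneg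
  linarith

theorem ascPochhammer_eval_ne_zero_of_re_pos {c : ℂ} (hc : 0 < c.re) (n : ℕ) :
    (ascPochhammer ℂ n).eval c ≠ 0 := by
  induction n with
  | zero => simp
  | succ n ih =>
    rw [ascPochhammer_succ_eval]
    exact mul_ne_zero ih (add_natCast_ne_zero_of_re_pos hc n)

@[simp]
theorem baileyTerm_zero (a c : ℂ) : baileyTerm a c 0 = 1 := by
  simp [baileyTerm]

theorem baileyTerm_succ (a c : ℂ) (n : ℕ) :
    baileyTerm a c (n + 1) =
      baileyTerm a c n * ((a + n) * (1 - a + n) / (2 * (n + 1) * (c + n))) := by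
  simp only [baileyTerm, ascPochhammer_succ_eval, Nat.factorial_succ, pow_succ, mul_inv, div_eq_mul_inv,
    Nat.cast_mul, Nat.cast_add, Nat.cast_one]
  ring

theorem tendsto_add_natCast_div_natCast (z : ℂ) :
    Filter.Tendsto (fun n : ℕ => (z + n) / (n : ℂ)) Filter.atTop (nhds 1) := by
  have h : Filter.Tendsto (fun n : ℕ => z / (n : ℂ) + 1) Filter.atTop (nhds (0 + 1)) :=
    (tendsto_const_div_atTop_nhds_zero_nat z).add_const 1
  rw [zero_add] at h
  refine h.congr' ?_
  filter_upwards [Filter.eventually_ne_atTop 0] with n hn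
  have : (n : ℂ) ≠ 0 := Nat.cast_ne_zero.mpr hn
  field_simp

theorem summable_norm_baileyTerm (a c : ℂ) : Summable fun n => ‖baileyTerm a c n‖ := by
  have hlim : Filter.Tendsto
      (fun n : ℕ => (a + n) * (1 - a + n) / (2 * (n + 1) * (c + n))) Filter.atTop
      (nhds (1 / 2 : ℂ)) := by
    have h := (((tendsto_add_natCast_div_natCast a).mul (tendsto_add_natCast_div_natCast (1 - a))).div
      (((tendsto_add_natCast_div_natCast 1).const_mul 2).mul (tendsto_add_natCast_div_natCast c))
      (by norm_num))
    norm_num at h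
    refine h.congr' ?_
    filter_upwards [Filter.eventually_ne_atTop 0] with n hn
    have : (n : ℂ) ≠ 0 := Nat.cast_ne_zero.mpr hn
    simp only [Pi.div_apply]
    rw [show 2 * ((1 + (n : ℂ)) / n) * ((c + n) / n) = 2 * (n + 1) * (c + n) / (n * n) by ring,
      div_mul_div_comm, div_div_div_cancel_right₀ (mul_ne_zero this this)]
  -- Any ratio strictly between the limit `1 / 2` and `1` would do.
  have hev := (hlim.norm).eventually (ge_mem_nhds (show ‖(1 / 2 : ℂ)‖ < 3 / 4 by norm_num))
  refine Summable.norm (summable_of_ratio_norm_eventually_le (r := 3 / 4) (by norm_num) ?_)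
  filter_upwards [hev] with n hn
  rw [baileyTerm_succ, norm_mul, mul_comm]
  gcongr

theorem ascPochhammer_eval_add_two {c : ℂ} (n : ℕ) :
    c * (c + 1) * (ascPochhammer ℂ n).eval (c + 2) =
      (ascPochhammer ℂ n).eval c * ((c + n) * (c + n + 1)) := by
  induction n with
  | zero => simp
  | succ n ih =>
    rw [ascPochhammer_succ_eval, ascPochhammer_succ_eval, ← mul_assoc, ih]
    push_cast
    ring

/-- The contiguous relation for `₂F₁(a, 1 - a; c; 1/2)` under `c ↦ c + 2`. -/
theorem tsum_baileyTerm_add_two (a : ℂ) {c : ℂ} (hc : 0 < c.re) :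
    ∑' n, baileyTerm a c n =
      (c + a) * (c + 1 - a) / (c * (c + 1)) * ∑' n, baileyTerm a (c + 2) n := by
  have hs := (summable_norm_baileyTerm a c).of_norm
  have hs2 := (summable_norm_baileyTerm a (c + 2)).of_norm
  have hc0 : ∀ n : ℕ, c + n ≠ 0 := add_natCast_ne_zero_of_re_pos hc
  have h0 : c ≠ 0 := by simpa using hc0 0
  have h1 : c + 1 ≠ 0 := by simpa using hc0 1
  -- Telescoping certificate: the termwise difference of the two sides is `s (n + 1) - s n`, with `s
  -- 0 = 0` and `s n → 0`.
  set s : ℕ → ℂ := fun n => -2 * (n / (c + n)) * baileyTerm a c n with hs_def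
  have hstep : ∀ n, baileyTerm a c n -
      (c + a) * (c + 1 - a) / (c * (c + 1)) * baileyTerm a (c + 2) n = s (n + 1) - s n := by
    intro n
    have hn := hc0 n
    have hn1 : c + n + 1 ≠ 0 := by simpa [add_assoc] using hc0 (n + 1)
    have hn2 : (n : ℂ) + 1 ≠ 0 := Nat.cast_add_one_ne_zero n
    have hb : baileyTerm a (c + 2) n =
        c * (c + 1) / ((c + n) * (c + n + 1)) * baileyTerm a c n := by
      have hp := ascPochhammer_eval_ne_zero_of_re_pos hc n
      have he : (ascPochhammer ℂ n).eval (c + 2) =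
          (ascPochhammer ℂ n).eval c * ((c + n) * (c + n + 1)) / (c * (c + 1)) := by
        rw [← ascPochhammer_eval_add_two]; field_simp
      simp only [baileyTerm, he]
      field_simp
    simp only [hs_def]
    rw [hb, baileyTerm_succ]
    push_cast
    rw [← add_assoc c]
    field_simp
    ring
  have hs0 : Filter.Tendsto s Filter.atTop (nhds 0) := by
    have h := ((tendsto_add_natCast_div_natCast c).inv₀ one_ne_zero).const_mul (-2)
    have h' := h.mul hs.tendsto_atTop_zero
    simpa [hs_def] using h'
  have hsum := hs.sub (hs2.mul_left ((c + a) * (c + 1 - a) / (c * (c + 1))))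
  have hz : ∑' n, (baileyTerm a c n -
      (c + a) * (c + 1 - a) / (c * (c + 1)) * baileyTerm a (c + 2) n) = 0 := by
    refine tendsto_nhds_unique hsum.hasSum.tendsto_sum_nat ?_
    simp_rw [hstep, Finset.sum_range_sub]
    simpa [hs_def] using hs0
  rw [hs.tsum_sub (hs2.mul_left _), tsum_mul_left] at hz
  exact sub_eq_zero.mp hz

/-- Since `0 < c.re`, shifting `c` to the right only enlarges the denominators `c + n`. This gives
the domination, uniform in `N`, for the limit below. -/
theorem norm_baileyTerm_add_le (a : ℂ) {c : ℂ} (hc : 0 < c.re) (N n : ℕ) :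
    ‖baileyTerm a (c + N) n‖ ≤ ‖baileyTerm a c n‖ := by
  have hN : (0 : ℝ) ≤ N := N.cast_nonneg
  have hcN : 0 < (c + N).re := by simp; linarith
  induction n with
  | zero => simp
  | succ n ih =>
    rw [baileyTerm_succ, baileyTerm_succ, norm_mul, norm_mul, norm_div, norm_div, norm_mul (2 * _),
      norm_mul (2 * _)]
    have hpos : 0 < ‖c + (n : ℂ)‖ := norm_pos_iff.mpr (add_natCast_ne_zero_of_re_pos hc n)
    have h2 : 0 < ‖2 * ((n : ℂ) + 1)‖ :=
      norm_pos_iff.mpr (mul_ne_zero two_ne_zero (Nat.cast_add_one_ne_zero n))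
    have hle : ‖c + (n : ℂ)‖ ≤ ‖c + N + (n : ℂ)‖ := by
      rw [Complex.norm_eq_sqrt_sq_add_sq, Complex.norm_eq_sqrt_sq_add_sq]
      have hn : (0 : ℝ) ≤ n := n.cast_nonneg
      apply Real.sqrt_le_sqrt
      simp
      nlinarith
    gcongr

theorem tendsto_tsum_baileyTerm (a : ℂ) {c : ℂ} (hc : 0 < c.re) :
    Filter.Tendsto (fun N : ℕ => ∑' n, baileyTerm a (c + N) n) Filter.atTop (nhds 1) := by
  have h1 : (1 : ℂ) = ∑' n : ℕ, if n = 0 then 1 else 0 := by simp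
  rw [h1]
  refine tendsto_tsum_of_dominated_convergence (summable_norm_baileyTerm a c) ?_
    (Filter.Eventually.of_forall fun N n => norm_baileyTerm_add_le a hc N n)
  intro n
  induction n with
  | zero => simp
  | succ n ih =>
    have hinv : Filter.Tendsto (fun N : ℕ => (2 * ((n : ℂ) + 1) * (c + N + n))⁻¹) Filter.atTop
        (nhds 0) := by
      refine Filter.tendsto_inv₀_cobounded.comp ?_
      refine (Filter.tendsto_mul_left_cobounded
        (mul_ne_zero two_ne_zero (Nat.cast_add_one_ne_zero n))).comp ?_
      exact (tendsto_add_const_cobounded (n : ℂ)).comp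
        ((tendsto_const_add_cobounded c).comp tendsto_natCast_atTop_cobounded)
    have h := ih.mul (hinv.const_mul ((a + n) * (1 - a + n)))
    simp only [mul_zero] at h
    simpa [baileyTerm_succ, div_eq_mul_inv] using h

/-- The factors are halved so that each product is of the form found in `Complex.GammaSeq`. -/
theorem tsum_baileyTerm_eq_prod_mul (a : ℂ) {c : ℂ} (hc : 0 < c.re) (N : ℕ) :
    ∑' n, baileyTerm a c n =
      (∏ k ∈ Finset.range N, (((c + a) / 2 + k) * ((c + 1 - a) / 2 + k) /
        ((c / 2 + k) * ((c + 1) / 2 + k)))) * ∑' n, baileyTerm a (c + (2 * N : ℕ)) n := by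
  induction N with
  | zero => simp
  | succ N ih =>
    have hN : (0 : ℝ) ≤ N := N.cast_nonneg
    have hcN : 0 < (c + (2 * N : ℕ)).re := by simp; linarith
    rw [ih, Finset.prod_range_succ, tsum_baileyTerm_add_two a hcN, ← mul_assoc]
    have e : c + ((2 * N : ℕ) : ℂ) + 2 = c + ((2 * (N + 1) : ℕ) : ℂ) := by push_cast; ring
    rw [e]
    congr 2
    have h1 : c + 2 * (N : ℂ) ≠ 0 := by simpa using add_natCast_ne_zero_of_re_pos hc (2 * N)
    have h2 : c + 2 * (N : ℂ) + 1 ≠ 0 := by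
      simpa [add_assoc] using add_natCast_ne_zero_of_re_pos hc (2 * N + 1)
    have h3 : c / 2 + (N : ℂ) ≠ 0 := by
      intro h; apply h1; linear_combination 2 * h
    have h4 : (c + 1) / 2 + (N : ℂ) ≠ 0 := by
      intro h; apply h2; linear_combination 2 * h
    push_cast
    rw [div_eq_div_iff (mul_ne_zero h1 h2) (mul_ne_zero h3 h4)]
    ring

/-- Bailey's summation theorem for `₂F₁(a, 1 - a; c; 1/2)`. -/
theorem Gamma_mul_Gamma_mul_tsum_baileyTerm {a c : ℂ} (hc : 0 < c.re) (h₁ : 0 < ((c + a) / 2).re)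
    (h₂ : 0 < ((c + 1 - a) / 2).re) :
    Complex.Gamma ((c + a) / 2) * Complex.Gamma ((c + 1 - a) / 2) * ∑' n, baileyTerm a c n =
      Complex.Gamma (c / 2) * Complex.Gamma ((c + 1) / 2) := by
  -- `GammaSeq` at `N` has `N + 1` factors in its denominator, hence the shift.
  have hlim : Filter.Tendsto (fun N : ℕ => ∑' n, baileyTerm a (c + (2 * (N + 1) : ℕ)) n)
      Filter.atTop (nhds 1) :=
    (tendsto_tsum_baileyTerm a hc).comp
      (Filter.tendsto_atTop_mono (fun N => show N ≤ 2 * (N + 1) by omega) Filter.tendsto_id)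
  have hR := ((Complex.GammaSeq_tendsto_Gamma (c / 2)).mul
    (Complex.GammaSeq_tendsto_Gamma ((c + 1) / 2))).mul hlim
  rw [mul_one] at hR
  have hL := ((Complex.GammaSeq_tendsto_Gamma ((c + a) / 2)).mul
    (Complex.GammaSeq_tendsto_Gamma ((c + 1 - a) / 2))).mul_const (∑' n, baileyTerm a c n)
  refine tendsto_nhds_unique (hL.congr' ?_) hR
  filter_upwards [Filter.eventually_ne_atTop 0] with N hN
  have hN' : (N : ℂ) ≠ 0 := Nat.cast_ne_zero.mpr hN
  rw [tsum_baileyTerm_eq_prod_mul a hc (N + 1), ← mul_assoc]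
  congr 1
  simp only [Complex.GammaSeq, Finset.prod_div_distrib, Finset.prod_mul_distrib]
  have hp₁ : ∏ j ∈ Finset.range (N + 1), ((c + a) / 2 + (j : ℂ)) ≠ 0 :=
    Finset.prod_ne_zero_iff.mpr fun j _ => add_natCast_ne_zero_of_re_pos h₁ j
  have hp₂ : ∏ j ∈ Finset.range (N + 1), ((c + 1 - a) / 2 + (j : ℂ)) ≠ 0 :=
    Finset.prod_ne_zero_iff.mpr fun j _ => add_natCast_ne_zero_of_re_pos h₂ j
  -- Both pairs of Gamma arguments sum to `c + 1 / 2`, so the powers of `N` balance.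
  have hpow : (N : ℂ) ^ ((c + a) / 2) * (N : ℂ) ^ ((c + 1 - a) / 2) =
      (N : ℂ) ^ (c / 2) * (N : ℂ) ^ ((c + 1) / 2) := by
    rw [← Complex.cpow_add _ _ hN', ← Complex.cpow_add _ _ hN']
    congr 1; ring
  generalize (∏ j ∈ Finset.range (N + 1), ((c + a) / 2 + (j : ℂ))) = p₁ at *
  generalize (∏ j ∈ Finset.range (N + 1), ((c + 1 - a) / 2 + (j : ℂ))) = p₂ at *
  generalize (∏ j ∈ Finset.range (N + 1), (c / 2 + (j : ℂ))) = p₃ at *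
  generalize (∏ j ∈ Finset.range (N + 1), ((c + 1) / 2 + (j : ℂ))) = p₄ at *
  calc _ = ((N : ℂ) ^ ((c + a) / 2) * (N : ℂ) ^ ((c + 1 - a) / 2)) * (N.factorial : ℂ) ^ 2 *
        (p₁ / p₁) * (p₂ / p₂) / (p₃ * p₄) := by ring
    _ = _ := by rw [hpow, div_self hp₁, div_self hp₂]; ring

/-! ### Mellin transform of the Legendre function. -/

/-- `B(σ, b + n)` contributes `(b)_n / (σ + b)_n`, which replaces the lower parameter `b` by `σ +
b`. -/
theorem baileyTerm_mul_betaIntegral (a : ℂ) {b σ : ℂ} (hb : 0 < b.re) (hσ : 0 < σ.re) (n : ℕ) :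
    baileyTerm a b n * Complex.betaIntegral σ (b + n) =
      Complex.Gamma σ * Complex.Gamma b / Complex.Gamma (σ + b) * baileyTerm a (σ + b) n := by
  have hn : (0 : ℝ) ≤ n := n.cast_nonneg
  have hσb : 0 < (σ + b).re := by rw [Complex.add_re]; linarith
  have hpole : ∀ {z : ℂ}, 0 < z.re → ∀ k : ℕ, z ≠ -k := fun hz k h =>
    add_natCast_ne_zero_of_re_pos hz k (by rw [h]; ring)
  have h₁ := Complex.Gamma_add_nat_div_Gamma_eq (n := n) b (hpole hb)
  have h₂ := Complex.Gamma_add_nat_div_Gamma_eq (n := n) (σ + b) (hpole hσb)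
  have g₁ := Complex.Gamma_ne_zero_of_re_pos hb
  have g₂ := Complex.Gamma_ne_zero_of_re_pos hσb
  have p₁ := ascPochhammer_eval_ne_zero_of_re_pos hb n
  have p₂ := ascPochhammer_eval_ne_zero_of_re_pos hσb n
  rw [div_eq_iff g₁] at h₁
  rw [div_eq_iff g₂] at h₂
  rw [Complex.betaIntegral_eq_Gamma_mul_div _ _ hσ (by simp; linarith), ← add_assoc, h₁, h₂]
  simp only [baileyTerm]
  field_simp

theorem integrableOn_cpow_mul_one_sub_cpow {σ b : ℂ} (hσ : 0 < σ.re) (hb : 0 < b.re) :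
    IntegrableOn (fun x : ℝ => (x : ℂ) ^ (σ - 1) * (1 - (x : ℂ)) ^ (b - 1)) (Set.Ioo 0 1) :=
  (intervalIntegrable_iff_integrableOn_Ioo_of_le zero_le_one).mp
    (Complex.betaIntegral_convergent hσ hb)

theorem norm_baileyTerm_mul_pow_le (a c : ℂ) (n : ℕ) {x : ℝ} (hx : x ∈ Set.Icc (0 : ℝ) 1) :
    ‖baileyTerm a c n * (1 - (x : ℂ)) ^ n‖ ≤ ‖baileyTerm a c n‖ := by
  rw [norm_mul, norm_pow]
  have : ‖1 - (x : ℂ)‖ ≤ 1 := by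
    rw [← Complex.ofReal_one, ← Complex.ofReal_sub, Complex.norm_real, Real.norm_eq_abs, abs_le]
    constructor <;> linarith [hx.1, hx.2]
  exact mul_le_of_le_one_right (norm_nonneg _) (pow_le_one₀ (norm_nonneg _) this)

theorem continuousOn_tsum_baileyTerm_mul_pow (a c : ℂ) :
    ContinuousOn (fun x : ℝ => ∑' n, baileyTerm a c n * (1 - (x : ℂ)) ^ n) (Set.Icc 0 1) :=
  continuousOn_tsum (fun n => by fun_prop) (summable_norm_baileyTerm a c)
    fun n _ hx => norm_baileyTerm_mul_pow_le a c n hx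

theorem integrableOn_beta_mul_tsum_baileyTerm (a : ℂ) {σ b : ℂ} (hσ : 0 < σ.re) (hb : 0 < b.re) :
    IntegrableOn (fun x : ℝ => (∑' n, baileyTerm a b n * (1 - (x : ℂ)) ^ n) *
      ((x : ℂ) ^ (σ - 1) * (1 - (x : ℂ)) ^ (b - 1))) (Set.Ioo 0 1) := by
  refine Integrable.bdd_mul (c := ∑' n, ‖baileyTerm a b n‖)
    (integrableOn_cpow_mul_one_sub_cpow hσ hb) ?_ ?_
  · exact ((continuousOn_tsum_baileyTerm_mul_pow a b).mono
      Set.Ioo_subset_Icc_self).aestronglyMeasurable measurableSet_Ioo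
  · refine ae_restrict_of_forall_mem measurableSet_Ioo fun x hx => ?_
    exact tsum_of_norm_bounded (summable_norm_baileyTerm a b).hasSum
      fun n => norm_baileyTerm_mul_pow_le a b n (Set.Ioo_subset_Icc_self hx)

theorem integral_beta_mul_tsum_baileyTerm (a : ℂ) {σ b : ℂ} (hσ : 0 < σ.re) (hb : 0 < b.re) :
    ∫ x in Set.Ioo (0 : ℝ) 1, (∑' n, baileyTerm a b n * (1 - (x : ℂ)) ^ n) *
      ((x : ℂ) ^ (σ - 1) * (1 - (x : ℂ)) ^ (b - 1)) =
      Complex.Gamma σ * Complex.Gamma b / Complex.Gamma (σ + b) *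
        ∑' n, baileyTerm a (σ + b) n := by
  set g : ℝ → ℂ := fun x => (x : ℂ) ^ (σ - 1) * (1 - (x : ℂ)) ^ (b - 1) with hg_def
  have hg : IntegrableOn g (Set.Ioo 0 1) := integrableOn_cpow_mul_one_sub_cpow hσ hb
  set F : ℕ → ℝ → ℂ := fun n x => baileyTerm a b n * (1 - (x : ℂ)) ^ n * g x with hF_def
  have hle : ∀ n, ∀ x ∈ Set.Ioo (0 : ℝ) 1, ‖F n x‖ ≤ ‖baileyTerm a b n‖ * ‖g x‖ := by
    intro n x hx
    rw [hF_def, norm_mul]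
    gcongr
    exact norm_baileyTerm_mul_pow_le a b n (Set.Ioo_subset_Icc_self hx)
  have hF : ∀ n, IntegrableOn (F n) (Set.Ioo 0 1) := fun n =>
    Integrable.bdd_mul (c := ‖baileyTerm a b n‖) hg (by fun_prop)
      (ae_restrict_of_forall_mem measurableSet_Ioo fun x hx =>
        norm_baileyTerm_mul_pow_le a b n (Set.Ioo_subset_Icc_self hx))
  have hsum : Summable fun n => ∫ x in Set.Ioo (0 : ℝ) 1, ‖F n x‖ := by
    refine Summable.of_nonneg_of_le (fun n => integral_nonneg fun x => norm_nonneg _) (fun n => ?_)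
      ((summable_norm_baileyTerm a b).mul_right (∫ x in Set.Ioo (0 : ℝ) 1, ‖g x‖))
    rw [← integral_const_mul]
    exact setIntegral_mono_on (hF n).norm (hg.norm.const_mul _) measurableSet_Ioo (hle n)
  have h := hasSum_integral_of_summable_integral_norm hF hsum
  have hint : ∀ n, ∫ x in Set.Ioo (0 : ℝ) 1, F n x =
      baileyTerm a b n * Complex.betaIntegral σ (b + n) := by
    intro n
    rw [Complex.betaIntegral, intervalIntegral.integral_of_le zero_le_one,
      integral_Ioc_eq_integral_Ioo, ← integral_const_mul]
    refine setIntegral_congr_fun measurableSet_Ioo fun x hx => ?_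
    have hx1 : (1 - (x : ℂ)) ≠ 0 := by
      rw [← Complex.ofReal_one, ← Complex.ofReal_sub]
      exact Complex.ofReal_ne_zero.mpr (sub_pos.mpr hx.2).ne'
    have hpow : (1 - (x : ℂ)) ^ (b + n - 1) = (1 - (x : ℂ)) ^ (b - 1) * (1 - (x : ℂ)) ^ n := by
      rw [← Complex.cpow_natCast, ← Complex.cpow_add _ _ hx1]
      congr 1; ring
    simp only [hF_def, hg_def, hpow]
    ring
  simp_rw [hint, baileyTerm_mul_betaIntegral a hb hσ] at h
  rw [← tsum_mul_left, h.tsum_eq]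
  refine integral_congr_ae (Filter.Eventually.of_forall fun x => ?_)
  simp only [hF_def]
  rw [tsum_mul_right]

/-- The powers of `1 + x` cancel and those of `1 - x` combine to a Beta weight. The `2⁻ⁿ` from the
argument `(1 - x) / 2` is already in `baileyTerm`. -/
theorem legendreP_mul_eq (σ u v : ℂ) {x : ℝ} (hx : x ∈ Set.Ioo (0 : ℝ) 1) :
    (x : ℂ) ^ (σ - 1) * ((1 - x ^ 2 : ℝ) : ℂ) ^ (-u / 2) * legendreP v u x =
      (Complex.Gamma (1 - u))⁻¹ * ((∑' n, baileyTerm (-v) (1 - u) n * (1 - (x : ℂ)) ^ n) *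
        ((x : ℂ) ^ (σ - 1) * (1 - (x : ℂ)) ^ (1 - u - 1))) := by
  have hp : 0 < 1 + x := by linarith [hx.1]
  have hm : 0 < 1 - x := by linarith [hx.2]
  have hF : ordinaryHypergeometric (-v) (v + 1) (1 - u) (((1 - x) / 2 : ℝ) : ℂ) =
      ∑' n, baileyTerm (-v) (1 - u) n * (1 - (x : ℂ)) ^ n := by
    rw [ordinaryHypergeometric_eq_tsum]
    refine tsum_congr fun n => ?_
    rw [baileyTerm, smul_eq_mul, show 1 - -v = v + 1 by ring, mul_assoc _ ((1 / 2 : ℂ) ^ n), ← mul_pow]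
    congr 2
    push_cast
    ring
  have hsq : ((1 - x ^ 2 : ℝ) : ℂ) ^ (-u / 2) =
      (1 + (x : ℂ)) ^ (-u / 2) * (1 - (x : ℂ)) ^ (-u / 2) := by
    rw [show 1 - x ^ 2 = (1 + x) * (1 - x) by ring, Complex.ofReal_mul,
      Complex.mul_cpow_ofReal_nonneg hp.le hm.le]
    push_cast
    rfl
  have hdiv : (((1 + x) / (1 - x) : ℝ) : ℂ) ^ (u / 2) =
      (1 + (x : ℂ)) ^ (u / 2) * (1 - (x : ℂ)) ^ (-u / 2) := by
    rw [div_eq_mul_inv, Complex.ofReal_mul,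
      Complex.mul_cpow_ofReal_nonneg hp.le (inv_pos.mpr hm).le, Complex.ofReal_inv,
      Complex.inv_cpow _ _ (by rw [Complex.arg_ofReal_of_nonneg hm.le]; exact Real.pi_pos.ne),
      neg_div, Complex.cpow_neg]
    push_cast
    rfl
  have hpc : 1 + (x : ℂ) ≠ 0 := by exact_mod_cast hp.ne'
  have hmc : 1 - (x : ℂ) ≠ 0 := by exact_mod_cast hm.ne'
  have h₁ : (1 + (x : ℂ)) ^ (-u / 2) * (1 + (x : ℂ)) ^ (u / 2) = 1 := by
    rw [← Complex.cpow_add _ _ hpc, neg_div, neg_add_cancel, Complex.cpow_zero]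
  have h₂ : (1 - (x : ℂ)) ^ (-u / 2) * (1 - (x : ℂ)) ^ (-u / 2) =
      (1 - (x : ℂ)) ^ (1 - u - 1) := by
    rw [← Complex.cpow_add _ _ hmc]
    congr 1; ring
  rw [legendreP, hF, hsq, hdiv, ← h₂, div_eq_mul_inv _ (Complex.Gamma (1 - u))]
  linear_combination ((x : ℂ) ^ (σ - 1) * (1 - (x : ℂ)) ^ (-u / 2) * (1 - (x : ℂ)) ^ (-u / 2) *
    (Complex.Gamma (1 - u))⁻¹ * ∑' n, baileyTerm (-v) (1 - u) n * (1 - (x : ℂ)) ^ n) * h₁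

theorem integrableOn_cpow_mul_legendreP {σ u : ℂ} (v : ℂ) (hσ : 0 < σ.re) (hu : u.re < 1) :
    IntegrableOn (fun x : ℝ =>
      (x : ℂ) ^ (σ - 1) * ((1 - x ^ 2 : ℝ) : ℂ) ^ (-u / 2) * legendreP v u x) (Set.Ioo 0 1) :=
  IntegrableOn.congr_fun
    ((integrableOn_beta_mul_tsum_baileyTerm (-v) hσ (b := 1 - u) (by simpa using hu)).const_mul
      (Complex.Gamma (1 - u))⁻¹) (fun _ hx => (legendreP_mul_eq σ u v hx).symm) measurableSet_Ioo

/-- The Mellin transform on `(0, 1)` of `(1 - x²) ^ (-u / 2) * P_v^u(x)`. -/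
theorem integral_cpow_mul_legendreP {σ u v : ℂ} (hσ : 0 < σ.re) (hu : u.re < 1)
    (h₁ : 0 < ((σ - u - v + 1) / 2).re) (h₂ : 0 < ((σ - u + v) / 2 + 1).re) :
    (∫ x in (0 : ℝ)..1,
      (x : ℂ) ^ (σ - 1) * ((1 - x ^ 2 : ℝ) : ℂ) ^ (-u / 2) * legendreP v u x) *
      (Complex.Gamma ((σ - u + v) / 2 + 1) * Complex.Gamma ((σ - u - v + 1) / 2)) =
      2 ^ (u - σ) * (Real.sqrt Real.pi : ℂ) * Complex.Gamma σ := by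
  have hb : 0 < (1 - u).re := by simpa using hu
  have hc : 0 < (σ + (1 - u)).re := by rw [Complex.add_re]; linarith
  have e₁ : (σ - u - v + 1) / 2 = (σ + (1 - u) + -v) / 2 := by ring
  have e₂ : (σ - u + v) / 2 + 1 = (σ + (1 - u) + 1 - -v) / 2 := by ring
  have hB := Gamma_mul_Gamma_mul_tsum_baileyTerm hc (e₁ ▸ h₁) (e₂ ▸ h₂)
  -- Duplication turns Bailey's right side into a multiple of `Γ(σ + 1 - u)`, cancelling the Beta
  -- denominator.
  have hD := Complex.Gamma_mul_Gamma_add_half ((σ + (1 - u)) / 2)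
  rw [show (σ + (1 - u)) / 2 + 1 / 2 = (σ + (1 - u) + 1) / 2 by ring, ← hB,
    show 2 * ((σ + (1 - u)) / 2) = σ + (1 - u) by ring,
    show 1 - (σ + (1 - u)) = u - σ by ring] at hD
  rw [intervalIntegral.integral_of_le zero_le_one, integral_Ioc_eq_integral_Ioo,
    setIntegral_congr_fun measurableSet_Ioo fun x hx => legendreP_mul_eq σ u v hx,
    integral_const_mul, integral_beta_mul_tsum_baileyTerm (-v) hσ hb, e₁, e₂]
  have g₁ := Complex.Gamma_ne_zero_of_re_pos hb
  have g₂ := Complex.Gamma_ne_zero_of_re_pos hc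
  calc _ = Complex.Gamma σ / Complex.Gamma (σ + (1 - u)) *
        (Complex.Gamma ((σ + (1 - u) + -v) / 2) * Complex.Gamma ((σ + (1 - u) + 1 - -v) / 2) *
          ∑' n, baileyTerm (-v) (σ + (1 - u)) n) := by field_simp
    _ = _ := by rw [hD]; field_simp

/-! ### Logarithmic integrals as Gamma integrals. -/

theorem image_exp_neg_Ioi_zero : (fun x : ℝ => Real.exp (-x)) '' Set.Ioi 0 = Set.Ioo 0 1 := by
  ext y
  constructor
  · rintro ⟨x, hx, rfl⟩
    exact ⟨Real.exp_pos _, Real.exp_lt_one_iff.mpr (neg_lt_zero.mpr hx)⟩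
  · rintro ⟨h0, h1⟩
    exact ⟨-Real.log y, neg_pos.mpr (Real.log_neg h0 h1), by simp [Real.exp_log h0]⟩

theorem hasDerivWithinAt_exp_neg (x : ℝ) (s : Set ℝ) :
    HasDerivWithinAt (fun x : ℝ => Real.exp (-x)) (-Real.exp (-x)) s x := by
  simpa using ((hasDerivAt_neg x).exp).hasDerivWithinAt

theorem injOn_exp_neg (s : Set ℝ) : Set.InjOn (fun x : ℝ => Real.exp (-x)) s :=
  fun _ _ _ _ h => neg_injective (Real.exp_injective h)

theorem abs_deriv_smul_log_inv_cpow (s : ℂ) (x : ℝ) :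
    |-Real.exp (-x)| • (Real.log (1 / Real.exp (-x)) : ℂ) ^ s =
      (Real.exp (-x) : ℂ) * (x : ℂ) ^ (s + 1 - 1) := by
  simp [abs_of_pos (Real.exp_pos _)]

theorem integrableOn_log_inv_cpow {s : ℂ} (hs : -1 < s.re) :
    IntegrableOn (fun x : ℝ => (Real.log (1 / x) : ℂ) ^ s) (Set.Ioo 0 1) := by
  rw [← image_exp_neg_Ioi_zero, integrableOn_image_iff_integrableOn_abs_deriv_smul measurableSet_Ioi
    (fun x _ => hasDerivWithinAt_exp_neg x _) (injOn_exp_neg _)]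
  simp_rw [abs_deriv_smul_log_inv_cpow]
  exact Complex.GammaIntegral_convergent (by simp; linarith)

theorem integral_log_inv_cpow {s : ℂ} (hs : -1 < s.re) :
    ∫ x in (0 : ℝ)..1, (Real.log (1 / x) : ℂ) ^ s = Complex.Gamma (s + 1) := by
  rw [intervalIntegral.integral_of_le zero_le_one, integral_Ioc_eq_integral_Ioo,
    ← image_exp_neg_Ioi_zero, integral_image_eq_integral_abs_deriv_smul measurableSet_Ioi
    (fun x _ => hasDerivWithinAt_exp_neg x _) (injOn_exp_neg _)]
  simp_rw [abs_deriv_smul_log_inv_cpow]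
  rw [Complex.Gamma_eq_integral (by simp; linarith)]
  rfl

/-! ### Separation of variables and assembly. -/

theorem mainTheorem2 (m u v μ ν : ℂ)
    (hm0 : 0 < m.re) (hm1 : m.re < 1)
    (hu : u.re < 1) (hv : 0 < v.re) (hmv : m.re < |v.re|)
    (hμ : μ.re < 1) (hν : 0 < ν.re) (hmν : m.re < |ν.re|)
    (hz : -1 < ((m - u - v - 1) / 2).re)
    (hp : -1 < ((-μ - m - ν) / 2).re) :
    IntegrableOn
      (fun w : ℝ × ℝ × ℝ × ℝ × ℝ × ℝ =>
        sextupleKernel m u v μ ν w.1 w.2.1 w.2.2.1 w.2.2.2.1 w.2.2.2.2.1 w.2.2.2.2.2)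
      (Set.Ioo 0 1 ×ˢ Set.Ioo 0 1 ×ˢ Set.Ioo 0 1 ×ˢ Set.Ioo 0 1 ×ˢ Set.Ioo 0 1 ×ˢ Set.Ioo 0 1)
      volume ∧
    (∫ q in (0 : ℝ)..1, ∫ p in (0 : ℝ)..1, ∫ t in (0 : ℝ)..1,
      ∫ z in (0 : ℝ)..1, ∫ y in (0 : ℝ)..1, ∫ x in (0 : ℝ)..1,
        sextupleKernel m u v μ ν x y z t p q) =
      (Real.pi : ℂ) ^ 2 * (Complex.sin (Real.pi * m))⁻¹ * 2 ^ (μ + u - 1) := by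
  have hm' : 0 < (1 - m).re := by simpa using hm1
  have re_half : ∀ w : ℂ, (w / 2).re = w.re / 2 := fun w => by
    simp
  have ht : -1 < ((m - u + v) / 2).re := by rw [re_half]; simp; linarith
  have hq : -1 < ((-μ - m + ν + 1) / 2).re := by rw [re_half]; simp; linarith
  set fx : ℝ → ℂ := fun x =>
    (x : ℂ) ^ (m - 1) * ((1 - x ^ 2 : ℝ) : ℂ) ^ (-u / 2) * legendreP v u x with hfx
  -- The exponent `-m` is written as `σ - 1` with `σ = 1 - m`.
  set fy : ℝ → ℂ := fun y =>
    (y : ℂ) ^ (1 - m - 1) * ((1 - y ^ 2 : ℝ) : ℂ) ^ (-μ / 2) * legendreP ν μ y with hfy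
  set fp : ℝ → ℂ := fun p => (Real.log (1 / p) : ℂ) ^ ((-μ - m - ν) / 2) with hfp
  set fq : ℝ → ℂ := fun q => (Real.log (1 / q) : ℂ) ^ ((-μ - m + ν + 1) / 2) with hfq
  set ft : ℝ → ℂ := fun t => (Real.log (1 / t) : ℂ) ^ ((m - u + v) / 2) with hft
  set fz : ℝ → ℂ := fun z => (Real.log (1 / z) : ℂ) ^ ((m - u - v - 1) / 2) with hfz
  have hker : ∀ x y z t p q : ℝ, sextupleKernel m u v μ ν x y z t p q =
      fx x * (fy y * (fz z * (ft t * (fp p * fq q)))) := by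
    intro x y z t p q
    simp only [sextupleKernel, hfx, hfy, hfp, hfq, hft, hfz, sub_sub_cancel_left]
    ring
  constructor
  · simp_rw [hker]
    rw [IntegrableOn]
    simp only [Measure.volume_eq_prod, ← Measure.prod_restrict]
    exact (integrableOn_cpow_mul_legendreP v hm0 hu).mul_prod
      ((integrableOn_cpow_mul_legendreP ν hm' hμ).mul_prod
        ((integrableOn_log_inv_cpow hz).mul_prod ((integrableOn_log_inv_cpow ht).mul_prod
          ((integrableOn_log_inv_cpow hp).mul_prod (integrableOn_log_inv_cpow hq)))))
  · simp only [hker, intervalIntegral.integral_const_mul, intervalIntegral.integral_mul_const]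
    have ez : (m - u - v - 1) / 2 + 1 = (m - u - v + 1) / 2 := by ring
    have ep : (-μ - m - ν) / 2 + 1 = (1 - m - μ - ν + 1) / 2 := by ring
    have eq' : (-μ - m + ν + 1) / 2 = (1 - m - μ + ν) / 2 := by ring
    have hX := integral_cpow_mul_legendreP hm0 hu (v := v)
      (by rw [← ez, Complex.add_re, Complex.one_re]; linarith)
      (by rw [Complex.add_re, Complex.one_re]; linarith)
    have hY := integral_cpow_mul_legendreP hm' hμ (v := ν)
      (by rw [← ep, Complex.add_re, Complex.one_re]; linarith)
      (by rw [← eq', Complex.add_re, Complex.one_re]; linarith)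
    have hZ := integral_log_inv_cpow hz
    have hT := integral_log_inv_cpow ht
    have hP := integral_log_inv_cpow hp
    have hQ := integral_log_inv_cpow hq
    rw [ez] at hZ
    rw [ep] at hP
    rw [eq'] at hQ
    -- The Gamma factors of each Mellin formula are traded for the logarithmic integrals, so no
    -- division is needed.
    rw [← hZ, ← hT] at hX
    rw [← hP, ← hQ, ← eq'] at hY
    have hG := Complex.Gamma_mul_Gamma_one_sub m
    have h2 : (2 : ℂ) ^ (u - m) * 2 ^ (μ - (1 - m)) = 2 ^ (μ + u - 1) := by
      rw [← Complex.cpow_add _ _ two_ne_zero]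
      congr 1; ring
    have hs : (Real.sqrt Real.pi : ℂ) * (Real.sqrt Real.pi : ℂ) = Real.pi := by
      rw [← Complex.ofReal_mul, Real.mul_self_sqrt Real.pi_pos.le]
    calc _ = (2 ^ (u - m) * (Real.sqrt Real.pi : ℂ) * Complex.Gamma m) *
          (2 ^ (μ - (1 - m)) * (Real.sqrt Real.pi : ℂ) * Complex.Gamma (1 - m)) := by
          rw [← hX, ← hY]; ring
      _ = (2 ^ (u - m) * 2 ^ (μ - (1 - m))) *
          ((Real.sqrt Real.pi : ℂ) * (Real.sqrt Real.pi : ℂ)) *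
          (Complex.Gamma m * Complex.Gamma (1 - m)) := by ring
      _ = _ := by rw [h2, hs, hG, div_eq_mul_inv]; ring
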